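/- For finite sets $P$ of points and $\mathcal{L}$ of lines in the Euclidean plane, let $I(P,\mathcal{L})=\{(p,\ell)\in P\times\mathcal{L}: p\in\ell\}$ be the set of incidences, and let the incidence graph of $(P,\mathcal{L})$ be the bipartite graph with vertex parts $P$ and $\mathcal{L}$ and edge set $I(P,\mathcal{L})$. Say that $(P,\mathcal{L})$ contains a subconfiguration isomorphic to $(P_0,\mathcal{L}_0)$ if there are $P'\subseteq P$ and $\mathcal{L}'\subseteq\mathcal{L}$ such that the incidence graphs of $(P',\mathcal{L}')$ and $(P_0,\mathcal{L}_0)$ are isomorphic. Theorem. For every integer $t>1$ there is a constant $c=c(t)$, depending only on $t$, such that the following holds. Let $\mathcal{L}_1$ and $\mathcal{L}_2$ be two sets of $t$ lines in the plane such that the set $P_0=\{\ell_1\cap\ell_2:\ell_1\in\mathcal{L}_1,\ \ell_2\in\mathcal{L}_2\}$ of intersection points satisfies $|P_0|=t^2$. Let $P$ be a set of $m$ points and $\mathcal{L}$ a set of $n$ lines in the plane such that $(P,\mathcal{L})$ does not contain a subconfiguration isomorphic to $(P_0,\mathcal{L}_1\cup\mathcal{L}_2)$. Then $$|I(P,\mathcal{L})|\le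 c\left(m^{\frac{2t-2}{3t-2}}\,n^{\frac{2t-1}{3t-2}}+m^{1+\frac{1}{6t-3}}+n\right).$$ -/

import Mathlib

namespace PointLine

/-- The Euclidean plane. -/
abbrev Plane : Type := EuclideanSpace ℝ (Fin 2)

/-- Lines in the plane: the affine subspaces of dimension one (these are automatically nonempty,
since the empty affine subspace has direction `⊥`). -/
abbrev Line : Type :=
  {ℓ : AffineSubspace ℝ Plane // Module.finrank ℝ ℓ.direction = 1}

/-- `I(P, L)`: the set of incidences between the points of `P` and the lines of `L`. -/
def incidences (P : Set Plane) (L : Set Line) : Set (Plane × Line) :=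
  {x | x.1 ∈ P ∧ x.2 ∈ L ∧ x.1 ∈ x.2.1}

/-- The incidence graph of `(P, L)`: the bipartite graph with vertex parts `P` and `L` in which
a point and a line are adjacent exactly when they are incident. -/
def incidenceGraph (P : Set Plane) (L : Set Line) : SimpleGraph (P ⊕ L) where
  Adj
    | .inl p, .inr ℓ => (p.1, ℓ.1) ∈ incidences P L
    | .inr ℓ, .inl p => (p.1, ℓ.1) ∈ incidences P L
    | _, _ => False
  symm := ⟨by rintro (p | ℓ) (q | k) h <;> exact h⟩
  loopless := ⟨by rintro (p | ℓ) h <;> exact h⟩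

/-- Two configurations are isomorphic if their incidence graphs are isomorphic. -/
def Isomorphic (P : Set Plane) (L : Set Line) (P₀ : Set Plane) (L₀ : Set Line) : Prop :=
  Nonempty (incidenceGraph P L ≃g incidenceGraph P₀ L₀)

/-- `(P, L)` contains a subconfiguration isomorphic to `(P₀, L₀)`. -/
def ContainsCopy (P : Set Plane) (L : Set Line) (P₀ : Set Plane) (L₀ : Set Line) : Prop :=
  ∃ P' ⊆ P, ∃ L' ⊆ L, Isomorphic P' L' P₀ L₀

/-- `{ℓ₁ ∩ ℓ₂ : ℓ₁ ∈ L₁, ℓ₂ ∈ L₂}`: the points that are the intersection point of a line of `L₁`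
and a line of `L₂`. -/
def crossings (L₁ L₂ : Set Line) : Set Plane :=
  {p | ∃ ℓ₁ ∈ L₁, ∃ ℓ₂ ∈ L₂, (ℓ₁.1 : Set Plane) ∩ (ℓ₂.1 : Set Plane) = {p}}

end PointLine

/-!
Pair up the lines through each point. In the graph that the pairs form on the `n` lines, a copy of
`K_{t,t}` is a `t × t` grid whose crossings are distinct points, because two points lie on at most
one common line. In the absence of grids the Kővári–Sós–Turán theorem bounds the number of
incidences by `m + 4 t n ^ (2 - 1 / t)`.

This bound is applied in the cells of a cutting. Under duality the `m` points become lines and the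
`n` lines become points, swept by slope. At each time the dual lines are ordered by height; cut
this order into blocks of length about `q`, and the history of each block into phases in which
fewer than `q` lines enter it. Two dual lines cross only once, so for a suitable offset of the
blocks there are at most `m / q + 2 + m ^ 2 / q ^ 2` cells, each met by at most `2 q` dual lines. A
line with at most `q` points meets two cells, and the lines with more than `q` points carry at most
`m ^ 2 / q` incidences. Taking `q = m / r` and splitting the lines of a cell into groups of size
`n / r ^ 2`, with `r` chosen to balance the two terms of the pairing bound, gives the theorem.
-/

namespace PointLine

open Finset Rel

section KovariSosTuran

variable {α β : Type*} {R : α → β → Prop} [DecidableRel R] {A : Finset α} {B : Finset β} {s t : ℕ}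

/-- Double counting of the stars with centre in `A` and `t` leaves in `B`. -/
theorem sum_choose_card_le (h : ∀ U ⊆ B, #U = t → #{x ∈ A | ∀ y ∈ U, R x y} ≤ s) :
    ∑ x ∈ A, (#{y ∈ B | R x y}).choose t ≤ s * (#B).choose t := by
  have stars (x : α) : #((B.powersetCard t).bipartiteAbove (fun x U => ∀ y ∈ U, R x y) x) =
      (#{y ∈ B | R x y}).choose t := by
    rw [← card_powersetCard]
    congr 1
    ext U
    simp only [mem_bipartiteAbove, mem_powersetCard, subset_iff, mem_filter]
    grind
  calc ∑ x ∈ A, (#{y ∈ B | R x y}).choose t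
      = ∑ U ∈ B.powersetCard t, #(A.bipartiteBelow (fun x U => ∀ y ∈ U, R x y) U) := by
        simp only [← stars]
        exact sum_card_bipartiteAbove_eq_sum_card_bipartiteBelow _
    _ ≤ #(B.powersetCard t) • s :=
        sum_le_card_nsmul _ _ _ fun U hU => h U (mem_powersetCard.1 hU).1 (mem_powersetCard.1 hU).2
    _ = s * (#B).choose t := by rw [card_powersetCard, smul_eq_mul, mul_comm]

theorem sum_card_add_one_sub_pow_le
    (h : ∀ U ⊆ B, #U = t → #{x ∈ A | ∀ y ∈ U, R x y} ≤ s) :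
    ∑ x ∈ A, (#{y ∈ B | R x y} + 1 - t) ^ t ≤ s * #B ^ t :=
  calc ∑ x ∈ A, (#{y ∈ B | R x y} + 1 - t) ^ t
      ≤ ∑ x ∈ A, t.factorial * (#{y ∈ B | R x y}).choose t := by
        gcongr with x
        rw [← Nat.descFactorial_eq_factorial_mul_choose]
        exact Nat.pow_sub_le_descFactorial _ _
    _ ≤ t.factorial * (s * (#B).choose t) := by
        rw [← mul_sum]
        gcongr
        exact sum_choose_card_le h
    _ = s * (#B).descFactorial t := by
        rw [Nat.descFactorial_eq_factorial_mul_choose, mul_left_comm]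
    _ ≤ s * #B ^ t := by
        gcongr
        exact Nat.descFactorial_le_pow _ _

/-- The Kővári–Sós–Turán theorem. -/
theorem sum_card_le_of_card_common_le (ht : 1 ≤ t)
    (h : ∀ U ⊆ B, #U = t → #{x ∈ A | ∀ y ∈ U, R x y} ≤ s) :
    (∑ x ∈ A, #{y ∈ B | R x y} : ℝ) ≤
      (s : ℝ) ^ (1 / t : ℝ) * #B * (#A : ℝ) ^ (1 - 1 / t : ℝ) + (t - 1) * #A := by
  obtain ⟨k, rfl⟩ := Nat.exists_eq_add_of_le' ht
  rcases A.eq_empty_or_nonempty with rfl | hA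
  · simp only [sum_empty, card_empty, CharP.cast_eq_zero, mul_zero, add_zero]
    positivity
  have hA₀ : (0 : ℝ) < #A := by exact_mod_cast hA.card_pos
  let f (x : α) : ℝ := (#{y ∈ B | R x y} + 1 - (k + 1) : ℕ)
  have deg_le (x : α) : (#{y ∈ B | R x y} : ℝ) ≤ f x + k := by
    simp only [f]
    norm_cast
    omega
  have pow_le : (∑ x ∈ A, f x) ^ (k + 1) ≤ s * (#B : ℝ) ^ (k + 1) * (#A : ℝ) ^ k := by
    have jensen := pow_sum_div_card_le_sum_pow (s := A) (f := f) (fun _ _ => Nat.cast_nonneg _) k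
    have moment : ∑ x ∈ A, f x ^ (k + 1) ≤ s * (#B : ℝ) ^ (k + 1) := by
      simp only [f]
      exact_mod_cast sum_card_add_one_sub_pow_le h
    exact (div_le_iff₀ (by positivity)).1 (jensen.trans moment)
  have root : (s : ℝ) * (#B : ℝ) ^ (k + 1) * (#A : ℝ) ^ k =
      ((s : ℝ) ^ (1 / (k + 1 : ℕ) : ℝ) * #B * (#A : ℝ) ^ (1 - 1 / (k + 1 : ℕ) : ℝ)) ^ (k + 1) := by
    rw [mul_pow, mul_pow, one_div, Real.rpow_inv_natCast_pow s.cast_nonneg k.succ_ne_zero,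
      ← Real.rpow_mul_natCast hA₀.le, ← Real.rpow_natCast (#A : ℝ) k]
    congr 2
    push_cast
    field_simp
    ring
  have sum_le := le_of_pow_le_pow_left₀ k.succ_ne_zero (by positivity) (pow_le.trans_eq root)
  calc (∑ x ∈ A, #{y ∈ B | R x y} : ℝ) ≤ ∑ x ∈ A, (f x + k) := sum_le_sum fun x _ => deg_le x
    _ = ∑ x ∈ A, f x + k * #A := by rw [sum_add_distrib, sum_const, nsmul_eq_mul, mul_comm]
    _ ≤ _ := by
        push_cast at sum_le ⊢
        linarith

theorem natCast_le_rpow {e : ℝ} (n : ℕ) (he : 1 ≤ e) : (n : ℝ) ≤ (n : ℝ) ^ e := by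
  rcases n.eq_zero_or_pos with rfl | hn
  · simpa using Real.rpow_nonneg le_rfl _
  · exact Real.self_le_rpow_of_one_le (by exact_mod_cast hn) he

theorem one_div_natCast_le_one {t : ℕ} (ht : 1 ≤ t) : 1 / (t : ℝ) ≤ 1 :=
  div_le_one_of_le₀ (by exact_mod_cast ht) t.cast_nonneg

theorem sum_card_le_of_card_common_lt {R : α → α → Prop} [DecidableRel R] (ht : 1 ≤ t)
    (h : ∀ U ⊆ A, #U = t → #{x ∈ A | ∀ y ∈ U, R x y} < t) :
    (∑ x ∈ A, #{y ∈ A | R x y} : ℝ) ≤ 2 * t * (#A : ℝ) ^ (2 - 1 / t : ℝ) := by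
  have ht' : (1 : ℝ) ≤ t := by exact_mod_cast ht
  have hexp := one_div_natCast_le_one ht
  have card_mul : (#A : ℝ) * (#A : ℝ) ^ (1 - 1 / t : ℝ) = (#A : ℝ) ^ (2 - 1 / t : ℝ) := by
    rw [← Real.rpow_one_add' (Nat.cast_nonneg _) (by linarith)]
    congr 1
    ring
  calc (∑ x ∈ A, #{y ∈ A | R x y} : ℝ)
      ≤ (t : ℝ) ^ (1 / t : ℝ) * #A * (#A : ℝ) ^ (1 - 1 / t : ℝ) + (t - 1) * #A :=
        sum_card_le_of_card_common_le ht fun U hU hc => (h U hU hc).le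
    _ ≤ t * (#A : ℝ) ^ (2 - 1 / t : ℝ) + t * (#A : ℝ) ^ (2 - 1 / t : ℝ) := by
        rw [mul_assoc, card_mul]
        gcongr
        · exact Real.rpow_le_self_of_one_le ht' hexp
        · linarith
        · exact natCast_le_rpow _ (by linarith)
    _ = 2 * t * (#A : ℝ) ^ (2 - 1 / t : ℝ) := by ring

end KovariSosTuran

section Incidence

variable {α β : Type*} {Inc : α → β → Prop} {P : Finset α} {L : Finset β} {t : ℕ}

/-- An incidence relation for which two points lie on at most one common line; equivalently, two
lines share at most one point. -/
def IsPartialLinear (Inc : α → β → Prop) : Prop :=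
  ∀ ⦃p q a b⦄, a ≠ b → Inc p a → Inc p b → Inc q a → Inc q b → p = q

/-- The point `p i j` lies on the line `a i` of a first family and on the line `b j` of a second
family, and on no other line of the two families. -/
structure IsGrid {ι κ : Type*} (Inc : α → β → Prop) (a : ι → β) (b : κ → β) (p : ι → κ → α) :
    Prop where
  inc_left : ∀ i j k, Inc (p i j) (a k) ↔ k = i
  inc_right : ∀ i j k, Inc (p i j) (b k) ↔ k = j

theorem IsGrid.reindex {ι κ ι' κ' : Type*} {a : ι → β} {b : κ → β} {p : ι → κ → α}
    (h : IsGrid Inc a b p) (e : ι' ≃ ι) (e' : κ' ≃ κ) :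
    IsGrid Inc (a ∘ e) (b ∘ e') fun i j => p (e i) (e' j) where
  inc_left _ _ _ := (h.inc_left _ _ _).trans e.apply_eq_iff_eq
  inc_right _ _ _ := (h.inc_right _ _ _).trans e'.apply_eq_iff_eq

theorem IsPartialLinear.isGrid {ι κ : Type*} (hInc : IsPartialLinear Inc) {a : ι → β} {b : κ → β}
    {p : ι → κ → α} (hne : ∀ i j, a i ≠ b j) (hpa : ∀ i j, Inc (p i j) (a i))
    (hpb : ∀ i j, Inc (p i j) (b j)) (hleft : ∀ j, Function.Injective fun i => p i j)
    (hright : ∀ i, Function.Injective (p i)) : IsGrid Inc a b p where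
  inc_left i j k :=
    ⟨fun hk => hleft j (hInc (hne k j) (hpa k j) (hpb k j) hk (hpb i j)), fun hk => hk ▸ hpa i j⟩
  inc_right i j k :=
    ⟨fun hk => hright i (hInc (hne i k) (hpa i k) (hpb i k) (hpa i j) hk), fun hk => hk ▸ hpb i j⟩

/-- No points of `P` and lines of `L` form a `t × t` grid. -/
def GridFree (Inc : α → β → Prop) (t : ℕ) (P : Finset α) (L : Finset β) : Prop :=
  ¬ ∃ (a b : Fin t → β) (p : Fin t → Fin t → α),
    (∀ i, a i ∈ L) ∧ (∀ j, b j ∈ L) ∧ (∀ i j, p i j ∈ P) ∧ IsGrid Inc a b p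

theorem GridFree.mono {P' : Finset α} {L' : Finset β} (h : GridFree Inc t P L) (hP : P' ⊆ P)
    (hL : L' ⊆ L) : GridFree Inc t P' L' :=
  fun ⟨a, b, p, ha, hb, hp, hgrid⟩ =>
    h ⟨a, b, p, fun i => hL (ha i), fun j => hL (hb j), fun i j => hP (hp i j), hgrid⟩

theorem exists_injective_of_le_card {A : Finset α} (h : t ≤ #A) :
    ∃ a : Fin t → α, Function.Injective a ∧ ∀ i, a i ∈ A := by
  obtain ⟨B, hBA, hB⟩ := exists_subset_card_eq h
  exact ⟨fun i => (B.equivFinOfCardEq hB).symm i,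
    Subtype.val_injective.comp (Equiv.injective _), fun i => hBA (Subtype.prop _)⟩

/-- A pairing of some of the lines through each point `p`: each `x ∈ B p` is paired with a
different line `f p x` of `L` through `p`. -/
structure IsPairing (Inc : α → β → Prop) (L : Finset β) (B : α → Finset β) (f : α → β → β) :
    Prop where
  mem : ∀ p, ∀ x ∈ B p, x ∈ L ∧ Inc p x
  map_mem : ∀ p, ∀ x ∈ B p, f p x ∈ L ∧ Inc p (f p x)
  map_ne : ∀ p, ∀ x ∈ B p, f p x ≠ x
  injOn : ∀ p, Set.InjOn (f p) (B p)

/-- The graph on the lines whose edges are the pairs formed at the points of `P`. -/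
def Paired (P : Finset α) (B : α → Finset β) (f : α → β → β) (x y : β) : Prop :=
  ∃ p ∈ P, x ∈ B p ∧ f p x = y

theorem exists_injOn_map_ne (A : Finset β) :
    ∃ B ⊆ A, ∃ f : β → β, Set.InjOn f B ∧ (∀ x ∈ B, f x ∈ A ∧ f x ≠ x) ∧ #A ≤ 2 * #B + 1 := by
  classical
  obtain ⟨B, hBA, hB⟩ := exists_subset_card_eq (s := A) (n := #A / 2) (by omega)
  obtain ⟨C, hCA, hC⟩ := exists_subset_card_eq (s := A \ B) (n := #A / 2)
    (by rw [card_sdiff_of_subset hBA]; omega)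
  cases isEmpty_or_nonempty β
  · exact ⟨∅, empty_subset A, id, by simp, by simp, by simp [A.eq_empty_of_isEmpty]⟩
  obtain ⟨f, hf⟩ := B.finite_toSet.exists_bijOn_of_encard_eq (t := (C : Set β)) (by simp [hB, hC])
  refine ⟨B, hBA, f, hf.injOn, fun x hx => ?_, by omega⟩
  have := mem_sdiff.1 (hCA (hf.mapsTo hx))
  exact ⟨this.1, fun h => this.2 (by rwa [h])⟩

theorem exists_isPairing [∀ p, DecidablePred (Inc p)] (L : Finset β) :
    ∃ B f, IsPairing Inc L B f ∧ ∀ p, #{l ∈ L | Inc p l} ≤ 2 * #(B p) + 1 := by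
  choose B hB f hinj hf hcard using fun p => exists_injOn_map_ne {l ∈ L | Inc p l}
  exact ⟨B, f, ⟨fun p _ hx => mem_filter.1 (hB p hx), fun p x hx => mem_filter.1 (hf p x hx).1,
    fun p x hx => (hf p x hx).2, hinj⟩, hcard⟩

namespace IsPairing

variable {B : α → Finset β} {f : α → β → β}

theorem isGrid {ι κ : Type*} (h : IsPairing Inc L B f) (hInc : IsPartialLinear Inc) {a : ι → β}
    {b : κ → β} {p : ι → κ → α} (ha : Function.Injective a) (hb : Function.Injective b)
    (hmem : ∀ i j, a i ∈ B (p i j)) (hmap : ∀ i j, f (p i j) (a i) = b j) :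
    IsGrid Inc a b p := by
  refine hInc.isGrid (fun i j => hmap i j ▸ (h.map_ne _ _ (hmem i j)).symm)
    (fun i j => (h.mem _ _ (hmem i j)).2) (fun i j => hmap i j ▸ (h.map_mem _ _ (hmem i j)).2)
    (fun j i k (hik : p i j = p k j) => ?_) (fun i j k hjk => ?_)
  · refine ha (h.injOn (p i j) (hmem i j) (by simpa [hik] using hmem k j) ?_)
    rw [hmap i j, hik, hmap k j]
  · refine hb ?_
    rw [← hmap i j, hjk, hmap i k]

theorem card_common_lt (h : IsPairing Inc L B f) (hInc : IsPartialLinear Inc)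
    (hfree : GridFree Inc t P L) [DecidableRel (Paired P B f)] {U : Finset β} (hU : U ⊆ L)
    (hUt : #U = t) : #{x ∈ L | ∀ y ∈ U, Paired P B f x y} < t := by
  by_contra! hle
  obtain ⟨a, ha, haS⟩ := exists_injective_of_le_card hle
  obtain ⟨b, hb, hbU⟩ := exists_injective_of_le_card hUt.ge
  choose p hpP hmem hmap using fun i j => (mem_filter.1 (haS i)).2 (b j) (hbU j)
  exact hfree ⟨a, b, p, fun i => (mem_filter.1 (haS i)).1, fun j => hU (hbU j), hpP,
    h.isGrid hInc ha hb hmem hmap⟩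

theorem sum_card_le_sum_card_paired (h : IsPairing Inc L B f) (hInc : IsPartialLinear Inc)
    [DecidableRel (Paired P B f)] :
    ∑ p ∈ P, #(B p) ≤ ∑ x ∈ L, #{y ∈ L | Paired P B f x y} := by
  rw [← card_sigma, ← card_sigma]
  refine card_le_card_of_injOn (fun z => ⟨z.2, f z.1 z.2⟩) ?_ ?_
  · rintro ⟨p, x⟩ hz
    obtain ⟨hp, hx⟩ := mem_sigma.1 hz
    exact mem_sigma.2 ⟨(h.mem p x hx).1, mem_filter.2 ⟨(h.map_mem p x hx).1, p, hp, hx, rfl⟩⟩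
  · rintro ⟨p, x⟩ hz ⟨q, y⟩ hw hzw
    obtain ⟨rfl, hf⟩ : x = y ∧ f p x = f q y := by simpa using hzw
    have hx := (mem_sigma.1 hz).2
    have hx' := (mem_sigma.1 hw).2
    rw [hInc (h.map_ne p x hx) (h.map_mem p x hx).2 (h.mem p x hx).2
      (hf ▸ (h.map_mem q x hx').2) (h.mem q x hx').2]

end IsPairing

variable [∀ p, DecidablePred (Inc p)]

theorem card_interedges_eq_sum_left (P : Finset α) (L : Finset β) :
    #(interedges Inc P L) = ∑ p ∈ P, #{l ∈ L | Inc p l} := by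
  simp only [interedges, card_filter, sum_product]

theorem card_interedges_eq_sum_right (P : Finset α) (L : Finset β) :
    #(interedges Inc P L) = ∑ l ∈ L, #{p ∈ P | Inc p l} := by
  simp only [interedges, card_filter, sum_product_right]

theorem card_interedges_union_right_le [DecidableEq β] (P : Finset α) (A B : Finset β) :
    #(interedges Inc P (A ∪ B)) ≤ #(interedges Inc P A) + #(interedges Inc P B) := by
  simp only [card_interedges_eq_sum_right]
  rw [← sum_union_inter]
  exact Nat.le_add_right _ _

theorem GridFree.card_interedges_le (h : GridFree Inc t P L) (hInc : IsPartialLinear Inc)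
    (ht : 1 ≤ t) :
    (#(interedges Inc P L) : ℝ) ≤ #P + 4 * t * (#L : ℝ) ^ (2 - 1 / t : ℝ) := by
  classical
  obtain ⟨B, f, hBf, hcard⟩ := exists_isPairing (Inc := Inc) L
  have paired_le : (∑ x ∈ L, #{y ∈ L | Paired P B f x y} : ℝ) ≤
      2 * t * (#L : ℝ) ^ (2 - 1 / t : ℝ) :=
    sum_card_le_of_card_common_lt ht fun U hU hUt => hBf.card_common_lt hInc h hU hUt
  have le_paired : (∑ p ∈ P, #(B p) : ℝ) ≤ ∑ x ∈ L, (#{y ∈ L | Paired P B f x y} : ℝ) := by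
    exact_mod_cast hBf.sum_card_le_sum_card_paired hInc
  calc (#(interedges Inc P L) : ℝ) ≤ ∑ p ∈ P, (2 * #(B p) + 1 : ℝ) := by
        rw [card_interedges_eq_sum_left]
        exact_mod_cast sum_le_sum fun p _ => hcard p
    _ = 2 * ∑ p ∈ P, (#(B p) : ℝ) + #P := by simp [sum_add_distrib, mul_sum]
    _ ≤ _ := by linarith

theorem le_card_div_add_one_mul_of_subadditive [DecidableEq β] {F : Finset β → ℝ} {w : ℕ} {D : ℝ}
    (hF : ∀ A B, F (A ∪ B) ≤ F A + F B) (hw : 1 ≤ w) (hD : ∀ A ⊆ L, #A ≤ w → F A ≤ D) :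
    F L ≤ (#L / w + 1) * D := by
  have hw' : (0 : ℝ) < w := by exact_mod_cast hw
  have hD₀ : 0 ≤ D := by
    have := hD ∅ (empty_subset L) (by simp)
    have := hF ∅ ∅
    rw [union_empty] at this
    linarith
  induction hn : #L using Nat.strong_induction_on generalizing L with
  | _ n ih =>
    subst hn
    rcases le_or_gt #L w with hLw | hwL
    · have : 0 ≤ (#L / w : ℝ) * D := by positivity
      linarith [hD L Subset.rfl hLw]
    · obtain ⟨W, hWL, hW⟩ := exists_subset_card_eq hwL.le
      have hcard : #(L \ W) = #L - w := by rw [card_sdiff_of_subset hWL, hW]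
      have hrest := ih #(L \ W) (by omega) (fun A hA => hD A (hA.trans sdiff_subset)) rfl
      rw [hcard, Nat.cast_sub hwL.le, sub_div, div_self hw'.ne', sub_add_cancel] at hrest
      calc F L = F (L \ W ∪ W) := by rw [sdiff_union_of_subset hWL]
        _ ≤ F (L \ W) + F W := hF _ _
        _ ≤ #L / w * D + D := add_le_add hrest (hD W hWL hW.le)
        _ = (#L / w + 1) * D := by ring

theorem GridFree.card_interedges_le_of_split (h : GridFree Inc t P L) (hInc : IsPartialLinear Inc)
    (ht : 1 ≤ t) {w : ℕ} (hw : 1 ≤ w) :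
    (#(interedges Inc P L) : ℝ) ≤ (#L / w + 1) * (#P + 4 * t * (w : ℝ) ^ (2 - 1 / t : ℝ)) := by
  classical
  refine le_card_div_add_one_mul_of_subadditive (F := fun A => (#(interedges Inc P A) : ℝ))
    (fun A B => by exact_mod_cast card_interedges_union_right_le P A B) hw fun A hA hAw => ?_
  have hexp : 0 ≤ 2 - 1 / (t : ℝ) := by linarith [one_div_natCast_le_one ht]
  refine ((h.mono Subset.rfl hA).card_interedges_le hInc ht).trans ?_
  gcongr

theorem sum_card_mul_pred_le (hInc : IsPartialLinear Inc) (P : Finset α) (L : Finset β) :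
    ∑ l ∈ L, #{p ∈ P | Inc p l} * (#{p ∈ P | Inc p l} - 1) ≤ #P ^ 2 := by
  classical
  have disjoint : (L : Set β).PairwiseDisjoint fun l => ({p ∈ P | Inc p l} : Finset α).offDiag := by
    refine fun a _ b _ hab => disjoint_left.2 fun x hxa hxb => ?_
    simp only [mem_offDiag, mem_filter] at hxa hxb
    exact hxa.2.2 (hInc hab hxa.1.2 hxb.1.2 hxa.2.1.2 hxb.2.1.2)
  calc ∑ l ∈ L, #{p ∈ P | Inc p l} * (#{p ∈ P | Inc p l} - 1)
      = #(L.biUnion fun l => ({p ∈ P | Inc p l} : Finset α).offDiag) := by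
        simp only [card_biUnion disjoint, offDiag_card, Nat.mul_sub_one]
    _ ≤ #(P ×ˢ P) := card_le_card fun x hx => by
        simp only [mem_biUnion, mem_offDiag, mem_filter] at hx
        obtain ⟨l, _, hx₁, hx₂, _⟩ := hx
        exact mem_product.2 ⟨hx₁.1, hx₂.1⟩
    _ = #P ^ 2 := by rw [card_product, sq]

theorem card_interedges_le_card_add_sq (hInc : IsPartialLinear Inc) (P : Finset α)
    (L : Finset β) : #(interedges Inc P L) ≤ #L + #P ^ 2 :=
  calc #(interedges Inc P L)
      ≤ ∑ l ∈ L, (1 + #{p ∈ P | Inc p l} * (#{p ∈ P | Inc p l} - 1)) := by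
        rw [card_interedges_eq_sum_right]
        refine sum_le_sum fun l _ => ?_
        rcases #{p ∈ P | Inc p l} with _ | _ | k
        · simp
        · simp
        · simp only [Nat.add_sub_cancel]
          nlinarith
    _ = #L + ∑ l ∈ L, #{p ∈ P | Inc p l} * (#{p ∈ P | Inc p l} - 1) := by
        rw [sum_add_distrib, card_eq_sum_ones]
    _ ≤ #L + #P ^ 2 := Nat.add_le_add_left (sum_card_mul_pred_le hInc P L) _

theorem mul_card_interedges_le_of_rich (hInc : IsPartialLinear Inc) {q : ℕ}
    (hq : ∀ l ∈ L, q < #{p ∈ P | Inc p l}) : q * #(interedges Inc P L) ≤ #P ^ 2 := by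
  refine le_trans ?_ (sum_card_mul_pred_le hInc P L)
  rw [card_interedges_eq_sum_right, mul_sum]
  refine sum_le_sum fun l hl => ?_
  rw [mul_comm]
  exact Nat.mul_le_mul_left _ (Nat.le_sub_one_of_lt (hq l hl))

/-- A covering of the incidences between `P` and `L` by subconfigurations `(pts K, lines K)`, as
provided by a cutting of the dual arrangement. -/
structure Cutting (Inc : α → β → Prop) (P : Finset α) (L : Finset β) (ι : Type*) where
  cells : Finset ι
  pts : ι → Finset α
  lines : ι → Finset β
  pts_subset : ∀ K, pts K ⊆ P
  lines_subset : ∀ K, lines K ⊆ L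
  exists_mem : ∀ p ∈ P, ∀ l ∈ L, Inc p l → ∃ K ∈ cells, p ∈ pts K ∧ l ∈ lines K

theorem Cutting.card_interedges_le {ι : Type*} (C : Cutting Inc P L ι) :
    #(interedges Inc P L) ≤ ∑ K ∈ C.cells, #(interedges Inc (C.pts K) (C.lines K)) := by
  classical
  refine le_trans (card_le_card fun x hx => ?_) card_biUnion_le
  obtain ⟨hp, hl, hinc⟩ := mem_interedges_iff.1 hx
  obtain ⟨K, hK, hpK, hlK⟩ := C.exists_mem _ hp _ hl hinc
  exact mem_biUnion.2 ⟨K, hK, mem_interedges_iff.2 ⟨hpK, hlK, hinc⟩⟩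

theorem GridFree.card_interedges_le_of_cutting {ι : Type*} (h : GridFree Inc t P L)
    (hInc : IsPartialLinear Inc) (ht : 1 ≤ t) {w M N : ℕ} (hw : 1 ≤ w) (C : Cutting Inc P L ι)
    (hM : ∀ K, #(C.pts K) ≤ M) (hN : ∑ K ∈ C.cells, #(C.lines K) ≤ N) :
    (#(interedges Inc P L) : ℝ) ≤
      (N / w + #C.cells) * (M + 4 * t * (w : ℝ) ^ (2 - 1 / t : ℝ)) := by
  set D : ℝ := M + 4 * t * (w : ℝ) ^ (2 - 1 / t : ℝ)
  calc (#(interedges Inc P L) : ℝ)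
      ≤ ∑ K ∈ C.cells, (#(interedges Inc (C.pts K) (C.lines K)) : ℝ) := by
        exact_mod_cast C.card_interedges_le
    _ ≤ ∑ K ∈ C.cells, (#(C.lines K) / w + 1) * D := by
        refine sum_le_sum fun K _ => ?_
        refine ((h.mono (C.pts_subset K) (C.lines_subset K)).card_interedges_le_of_split
          hInc ht hw).trans ?_
        simp only [D]
        gcongr
        exact hM K
    _ = ((∑ K ∈ C.cells, #(C.lines K) : ℕ) / w + #C.cells) * D := by
        simp [← sum_mul, sum_add_distrib, sum_div]
    _ ≤ (N / w + #C.cells) * D := by gcongr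

end Incidence

section Rank

variable {α γ : Type*} [LinearOrder γ] {P : Finset α} {g : α → γ} {p q : α}

/-- The number of elements of `P` that precede `p` in the order given by the key `g`. -/
def rank (P : Finset α) (g : α → γ) (p : α) : ℕ := #{q ∈ P | g q < g p}

theorem rank_le_card (P : Finset α) (g : α → γ) (p : α) : rank P g p ≤ #P := card_filter_le _ _

theorem rank_le_rank (h : g p ≤ g q) : rank P g p ≤ rank P g q :=
  card_le_card <| monotone_filter_right P fun _ _ hr => lt_of_lt_of_le hr h

theorem rank_lt_rank (hp : p ∈ P) (h : g p < g q) : rank P g p < rank P g q := by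
  refine card_lt_card <| (ssubset_iff_of_subset ?_).2 ⟨p, mem_filter.2 ⟨hp, h⟩, by simp⟩
  exact monotone_filter_right P fun _ _ hr => lt_trans hr h

theorem rank_injOn (hg : Set.InjOn g P) : Set.InjOn (rank P g) P := by
  refine fun p hp q hq hpq => hg hp hq (le_antisymm ?_ ?_)
  · exact not_lt.1 fun h => (rank_lt_rank hq h).ne hpq.symm
  · exact not_lt.1 fun h => (rank_lt_rank hp h).ne hpq

theorem exists_rank_mem_Ico {I : Set γ} [DecidablePred (· ∈ I)] (hI : I.OrdConnected) :
    ∃ a, ∀ p ∈ P, g p ∈ I → rank P g p ∈ Set.Ico a (a + #{p ∈ P | g p ∈ I}) := by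
  classical
  obtain hempty | hne := ({p ∈ P | g p ∈ I} : Finset α).eq_empty_or_nonempty
  · exact ⟨0, fun p hp hpI => (filter_eq_empty_iff.1 hempty hp hpI).elim⟩
  obtain ⟨p₀, hp₀, hmin⟩ := exists_min_image _ g hne
  refine ⟨rank P g p₀, fun p hp hpI => ?_⟩
  have hpmem : p ∈ ({p ∈ P | g p ∈ I} : Finset α) := mem_filter.2 ⟨hp, hpI⟩
  refine ⟨rank_le_rank (hmin p hpmem), ?_⟩
  have split : ({r ∈ P | g r < g p} : Finset α) ⊆
      {r ∈ P | g r < g p₀} ∪ ({r ∈ P | g r ∈ I} : Finset α).erase p := by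
    intro r hr
    obtain ⟨hr, hrp⟩ := mem_filter.1 hr
    rcases lt_or_ge (g r) (g p₀) with h | h
    · exact mem_union_left _ (mem_filter.2 ⟨hr, h⟩)
    · refine mem_union_right _ (mem_erase.2 ⟨fun h => hrp.ne (h ▸ rfl), mem_filter.2 ⟨hr, ?_⟩⟩)
      exact hI.out (mem_filter.1 hp₀).2 hpI ⟨h, hrp.le⟩
  calc rank P g p ≤ rank P g p₀ + #(({r ∈ P | g r ∈ I} : Finset α).erase p) :=
        (card_le_card split).trans (card_union_le _ _)
    _ < rank P g p₀ + #{r ∈ P | g r ∈ I} := by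
        have := card_erase_lt_of_mem hpmem
        omega

end Rank

section Sweep

variable {α ι γ : Type*} [LinearOrder γ] {P : Finset α}

/-- A family of keys, indexed by time, during which any two elements change their relative order
at most once. -/
def IsSweep [Preorder ι] (f : ι → α → γ) : Prop :=
  ∀ p q, Monotone (fun τ => f τ p < f τ q) ∨ Antitone (fun τ => f τ p < f τ q)

theorem IsSweep.comp {κ : Type*} [Preorder ι] [Preorder κ] {f : ι → α → γ} (hf : IsSweep f)
    {x : κ → ι} (hx : Monotone x) : IsSweep fun τ => f (x τ) :=
  fun p q => (hf p q).imp (fun h => h.comp hx) (fun h => h.comp_monotone hx)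

theorem sum_range_abs_sub_of_monotone_or_antitone {g : ℕ → ℤ} (hg : Monotone g ∨ Antitone g)
    (T : ℕ) : ∑ τ ∈ range T, |g (τ + 1) - g τ| = |g T - g 0| := by
  wlog h : Monotone g generalizing g
  · have := this (g := -g) (hg.symm.imp Antitone.neg Monotone.neg) (hg.resolve_left h).neg
    simpa only [Pi.neg_apply, neg_sub_neg, abs_sub_comm] using this
  simp only [abs_of_nonneg (sub_nonneg.2 (h (Nat.le_succ _))), sum_range_sub,
    abs_of_nonneg (sub_nonneg.2 (h T.zero_le))]

theorem IsSweep.sum_abs_rank_sub_le {f : ℕ → α → γ} (hf : IsSweep f) (P : Finset α) (T : ℕ)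
    (p : α) : ∑ τ ∈ range T, |(rank P (f (τ + 1)) p : ℤ) - rank P (f τ) p| ≤ #P := by
  let below (τ : ℕ) (q : α) : ℤ := if f τ q < f τ p then 1 else 0
  have rank_eq (τ : ℕ) : (rank P (f τ) p : ℤ) = ∑ q ∈ P, below τ q := by
    simp only [rank, card_filter, Nat.cast_sum, Nat.cast_ite, Nat.cast_one, Nat.cast_zero, below]
  have below_mono (q : α) : Monotone (fun τ => below τ q) ∨ Antitone (fun τ => below τ q) := by
    refine (hf q p).imp (fun h σ τ hστ => ?_) (fun h σ τ hστ => ?_) <;>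
    · have := h hστ
      simp only [le_Prop_eq] at this
      simp only [below]
      grind
  calc ∑ τ ∈ range T, |(rank P (f (τ + 1)) p : ℤ) - rank P (f τ) p|
      ≤ ∑ τ ∈ range T, ∑ q ∈ P, |below (τ + 1) q - below τ q| := by
        refine sum_le_sum fun τ _ => ?_
        rw [rank_eq, rank_eq, ← sum_sub_distrib]
        exact abs_sum_le_sum_abs _ _
    _ = ∑ q ∈ P, |below T q - below 0 q| := by
        rw [sum_comm]
        exact sum_congr rfl fun q _ => sum_range_abs_sub_of_monotone_or_antitone (below_mono q) T
    _ ≤ ∑ q ∈ P, 1 := by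
        refine sum_le_sum fun q _ => ?_
        simp only [below]
        split_ifs <;> simp
    _ = #P := by simp

end Sweep

section Blocks

variable {α : Type*} {P : Finset α} {q : ℕ}

/-- Hermite's identity. -/
theorem sum_range_add_div (hq : 0 < q) (a : ℕ) : ∑ s ∈ range q, (a + s) / q = a := by
  induction a with
  | zero => exact sum_eq_zero fun s hs => by rw [zero_add, Nat.div_eq_of_lt (mem_range.1 hs)]
  | succ a ih =>
    have shift := (sum_range_succ' (fun s => (a + s) / q) q).symm.trans
      (sum_range_succ (fun s => (a + s) / q) q)
    rw [ih, Nat.add_div_right _ hq, add_zero] at shift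
    have succ_add (s : ℕ) : a + 1 + s = a + (s + 1) := by omega
    simp only [succ_add]
    omega

theorem sum_range_abs_add_div_sub (hq : 0 < q) (a b : ℕ) :
    ∑ s ∈ range q, |(((a + s) / q : ℕ) : ℤ) - ((b + s) / q : ℕ)| = |(a : ℤ) - b| := by
  wlog hab : b ≤ a generalizing a b
  · simpa only [abs_sub_comm] using this b a (by omega)
  have le (s : ℕ) : (((b + s) / q : ℕ) : ℤ) ≤ ((a + s) / q : ℕ) := by
    exact_mod_cast Nat.div_le_div_right (by omega)
  simp only [abs_of_nonneg (sub_nonneg.2 (le _)), sum_sub_distrib]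
  rw [abs_of_nonneg (by omega), ← Nat.cast_sum, ← Nat.cast_sum, sum_range_add_div hq,
    sum_range_add_div hq]

theorem sum_range_card_add_div_ne_le (hq : 0 < q) (r r' : α → ℕ) :
    (∑ s ∈ range q, #{p ∈ P | (r p + s) / q ≠ (r' p + s) / q} : ℤ) ≤
      ∑ p ∈ P, |(r p : ℤ) - r' p| := by
  calc (∑ s ∈ range q, #{p ∈ P | (r p + s) / q ≠ (r' p + s) / q} : ℤ)
      ≤ ∑ s ∈ range q, ∑ p ∈ P, |(((r p + s) / q : ℕ) : ℤ) - ((r' p + s) / q : ℕ)| := by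
        refine sum_le_sum fun s _ => ?_
        rw [card_filter]
        push_cast
        refine sum_le_sum fun p _ => ?_
        split_ifs with h
        · exact Int.one_le_abs (sub_ne_zero.2 (by exact_mod_cast h))
        · exact abs_nonneg _
    _ = ∑ p ∈ P, |(r p : ℤ) - r' p| := by
        rw [sum_comm]
        exact sum_congr rfl fun p _ => sum_range_abs_add_div_sub hq _ _

/-- A random offset of the block boundaries achieves the bound on average. -/
theorem exists_offset (hq : 0 < q) {r : ℕ → α → ℕ} {T V : ℕ}
    (hV : ∀ p ∈ P, ∑ τ ∈ range T, |(r (τ + 1) p : ℤ) - r τ p| ≤ V) :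
    ∃ s < q, q * ∑ τ ∈ range T, #{p ∈ P | (r (τ + 1) p + s) / q ≠ (r τ p + s) / q} ≤ #P * V := by
  have average : (∑ s ∈ range q, ∑ τ ∈ range T,
      #{p ∈ P | (r (τ + 1) p + s) / q ≠ (r τ p + s) / q} : ℤ) ≤ #P * V := by
    rw [sum_comm]
    calc _ ≤ ∑ τ ∈ range T, ∑ p ∈ P, |(r (τ + 1) p : ℤ) - r τ p| :=
          sum_le_sum fun τ _ => sum_range_card_add_div_ne_le hq _ _
      _ ≤ #P • (V : ℤ) := by
          rw [sum_comm]
          exact sum_le_card_nsmul _ _ _ hV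
      _ = #P * V := nsmul_eq_mul _ _
  obtain ⟨s, hsq, hs⟩ := exists_le_of_sum_le (s := range q) (g := fun _ => #P * V)
    (f := fun s => q * ∑ τ ∈ range T, #{p ∈ P | (r (τ + 1) p + s) / q ≠ (r τ p + s) / q})
    ⟨0, mem_range.2 hq⟩ (by
      rw [← mul_sum, sum_const, card_range, smul_eq_mul]
      exact Nat.mul_le_mul_left q (by exact_mod_cast average))
  exact ⟨s, mem_range.1 hsq, hs⟩

theorem card_add_div_eq_le (hq : 0 < q) {r : α → ℕ} (hr : Set.InjOn r P) (s b : ℕ) :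
    #{p ∈ P | (r p + s) / q = b} ≤ q := by
  refine (card_le_card_of_injOn (t := Ico (b * q) (b * q + q)) (fun p => r p + s) ?_ ?_).trans
    (by simp)
  · intro p hp
    rw [mem_coe, mem_filter, Nat.div_eq_iff hq] at hp
    simp only [mem_coe, mem_Ico]
    omega
  · exact fun p hp p' hp' h =>
      hr (mem_filter.1 hp).1 (mem_filter.1 hp').1 (Nat.add_right_cancel h)

theorem add_div_eq_or_eq {a r : ℕ} (hq : 0 < q) (hr : r ∈ Set.Ico a (a + q)) (s : ℕ) :
    (r + s) / q = (a + s) / q ∨ (r + s) / q = (a + s) / q + 1 := by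
  have lower : (a + s) / q ≤ (r + s) / q := Nat.div_le_div_right (by have := hr.1; omega)
  have upper : (r + s) / q ≤ (a + s + q) / q := Nat.div_le_div_right (by have := hr.2; omega)
  rw [Nat.add_div_right _ hq] at upper
  omega

end Blocks

section Entries

variable {α : Type*} [DecidableEq α] {A : ℕ → Finset α} {P : Finset α} {q : ℕ}

/-- The number of times that an element enters the time-dependent set `A` up to time `τ`, those
present from the start not being counted. -/
def entries (A : ℕ → Finset α) (τ : ℕ) : ℕ := ∑ σ ∈ range τ, #(A (σ + 1) \ A σ)

theorem entries_mono (A : ℕ → Finset α) : Monotone (entries A) :=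
  fun _ _ h => sum_le_sum_of_subset (range_subset_range.2 h)

theorem card_biUnion_Icc_add_entries_le (A : ℕ → Finset α) {τ₀ τ₁ : ℕ} (h : τ₀ ≤ τ₁) :
    #((Icc τ₀ τ₁).biUnion A) + entries A τ₀ ≤ #(A τ₀) + entries A τ₁ := by
  induction τ₁, h using Nat.le_induction with
  | base => simp
  | succ τ hτ ih =>
    have subset : (Icc τ₀ (τ + 1)).biUnion A ⊆
        (Icc τ₀ τ).biUnion A ∪ (A (τ + 1) \ A τ) := by
      intro p hp
      simp only [mem_biUnion, mem_union, mem_sdiff, mem_Icc] at hp ⊢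
      grind
    have card := (card_le_card subset).trans (card_union_le _ _)
    have := sum_range_succ (fun σ => #(A (σ + 1) \ A σ)) τ
    simp only [entries] at ih ⊢
    omega

theorem card_biUnion_le_two_mul (hq : 0 < q) (hA : ∀ τ, #(A τ) ≤ q) {S : Finset ℕ} {v : ℕ}
    (hS : ∀ τ ∈ S, entries A τ / q = v) : #(S.biUnion A) ≤ 2 * q := by
  obtain rfl | hne := S.eq_empty_or_nonempty
  · simp
  have subset : S ⊆ Icc (S.min' hne) (S.max' hne) :=
    fun τ hτ => mem_Icc.2 ⟨S.min'_le τ hτ, S.le_max' τ hτ⟩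
  have hcard := card_le_card (biUnion_subset_biUnion_of_subset_left A subset)
  have hle := card_biUnion_Icc_add_entries_le A (S.min'_le _ (S.max'_mem hne))
  have hmin := (Nat.div_eq_iff hq).1 (hS _ (S.min'_mem hne))
  have hmax := (Nat.div_eq_iff hq).1 (hS _ (S.max'_mem hne))
  have := hA (S.min' hne)
  omega

theorem sum_entries_le (P : Finset α) (blk : ℕ → α → ℕ) (M : Finset ℕ) (T : ℕ) :
    ∑ b ∈ M, entries (fun τ => {p ∈ P | blk τ p = b}) T ≤
      ∑ τ ∈ range T, #{p ∈ P | blk (τ + 1) p ≠ blk τ p} := by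
  simp only [entries]
  rw [sum_comm]
  refine sum_le_sum fun τ _ => ?_
  rw [← card_biUnion]
  · refine card_le_card fun p hp => ?_
    simp only [mem_biUnion, mem_sdiff, mem_filter] at hp ⊢
    grind
  · refine fun b _ c _ hbc => disjoint_left.2 fun p hb hc => hbc ?_
    simp only [mem_sdiff, mem_filter] at hb hc
    exact hb.1.2.symm.trans hc.1.2

end Entries

section Cells

variable {α : Type*} [DecidableEq α] {P : Finset α} {blk : ℕ → α → ℕ} {q T M : ℕ}

/-- The cell to which the block `b` belongs at time `τ`: the history of a block is divided into
phases in each of which fewer than `q` elements enter it. -/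
def cell (P : Finset α) (blk : ℕ → α → ℕ) (q τ b : ℕ) : Σ _ : ℕ, ℕ :=
  ⟨b, entries (fun σ => {p ∈ P | blk σ p = b}) τ / q⟩

/-- The cells of the first `M` blocks up to time `T`. -/
def cells (P : Finset α) (blk : ℕ → α → ℕ) (q T M : ℕ) : Finset (Σ _ : ℕ, ℕ) :=
  (range M).sigma fun b => range (entries (fun σ => {p ∈ P | blk σ p = b}) T / q + 1)

theorem cell_mem_cells {τ b : ℕ} (hτ : τ ≤ T) (hb : b < M) :
    cell P blk q τ b ∈ cells P blk q T M :=
  mem_sigma.2 ⟨mem_range.2 hb,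
    mem_range.2 (Nat.lt_succ_of_le (Nat.div_le_div_right (entries_mono _ hτ)))⟩

theorem card_filter_cell_eq_le (hq : 0 < q) (hblk : ∀ τ b, #{p ∈ P | blk τ p = b} ≤ q) (T : ℕ)
    (K : Σ _ : ℕ, ℕ) : #{p ∈ P | ∃ τ < T, cell P blk q τ (blk τ p) = K} ≤ 2 * q := by
  obtain ⟨b, v⟩ := K
  let A (τ : ℕ) : Finset α := {p ∈ P | blk τ p = b}
  refine (card_le_card fun p hp => ?_).trans (card_biUnion_le_two_mul hq (fun τ => hblk τ b)
    (S := {τ ∈ range T | entries A τ / q = v}) (fun τ hτ => (mem_filter.1 hτ).2))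
  obtain ⟨hp', τ, hτ, hcell⟩ := mem_filter.1 hp
  simp only [cell, Sigma.mk.injEq, heq_eq_eq] at hcell
  obtain ⟨rfl, hv⟩ := hcell
  exact mem_biUnion.2 ⟨τ, mem_filter.2 ⟨mem_range.2 hτ, hv⟩, mem_filter.2 ⟨hp', rfl⟩⟩

theorem card_cells_le (P : Finset α) (blk : ℕ → α → ℕ) (q T M : ℕ) :
    (#(cells P blk q T M) : ℝ) ≤
      M + (∑ τ ∈ range T, #{p ∈ P | blk (τ + 1) p ≠ blk τ p} : ℕ) / q := by
  let E (b : ℕ) : ℕ := entries (fun σ => {p ∈ P | blk σ p = b}) T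
  calc (#(cells P blk q T M) : ℝ) = ∑ b ∈ range M, (((E b / q : ℕ) : ℝ) + 1) := by
        simp [cells, card_sigma, E]
    _ ≤ ∑ b ∈ range M, ((E b : ℝ) / q + 1) := by
        gcongr
        exact Nat.cast_div_le
    _ = M + (∑ b ∈ range M, E b : ℕ) / q := by
        simp [sum_add_distrib, sum_div, add_comm]
    _ ≤ _ := by
        gcongr
        exact sum_entries_le P blk (range M) T

end Cells

section SweepCutting

variable {α β ι γ : Type*} [LinearOrder γ] {Inc : α → β → Prop} {P : Finset α} {L : Finset β}
  {q : ℕ}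

theorem IsSweep.exists_blocks {f : ℕ → α → γ} (hf : IsSweep f) (P : Finset α) (hq : 0 < q)
    (T : ℕ) : ∃ s < q, q * ∑ τ ∈ range T, #{p ∈ P | (rank P (f (τ + 1)) p + s) / q ≠
      (rank P (f τ) p + s) / q} ≤ #P ^ 2 := by
  simpa only [sq] using exists_offset (r := fun τ => rank P (f τ)) hq
    fun p _ => hf.sum_abs_rank_sub_le P T p

theorem rank_add_div_lt {g : α → γ} {s : ℕ} (hs : s < q) (p : α) :
    (rank P g p + s) / q < #P / q + 2 := by
  have hq : 0 < q := by omega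
  have hrank := rank_le_card P g p
  calc (rank P g p + s) / q ≤ (#P + q) / q := Nat.div_le_div_right (by omega)
    _ < #P / q + 2 := by rw [Nat.add_div_right _ hq]; omega

theorem card_image_rank_add_div_le_two {g : α → γ} (hq : 0 < q) (s : ℕ) {I : Set γ}
    [DecidablePred (· ∈ I)] (hI : I.OrdConnected) (hcard : #{p ∈ P | g p ∈ I} ≤ q) :
    #(image (fun p => (rank P g p + s) / q) {p ∈ P | g p ∈ I}) ≤ 2 := by
  obtain ⟨a, ha⟩ := exists_rank_mem_Ico (P := P) (g := g) hI
  refine (card_le_card (t := {(a + s) / q, (a + s) / q + 1}) fun b hb => ?_).trans card_le_two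
  obtain ⟨p, hp, rfl⟩ := mem_image.1 hb
  obtain ⟨hp, hpI⟩ := mem_filter.1 hp
  rw [mem_insert, mem_singleton]
  exact add_div_eq_or_eq hq (Set.Ico_subset_Ico_right (by omega) (ha p hp hpI)) s

theorem sum_card_filter_le {κ : Type*} {R : κ → β → Prop} [DecidableRel R] (S : Finset κ) {d : ℕ}
    (h : ∀ l ∈ L, #{K ∈ S | R K l} ≤ d) : ∑ K ∈ S, #{l ∈ L | R K l} ≤ d * #L :=
  calc ∑ K ∈ S, #{l ∈ L | R K l} = ∑ l ∈ L, #{K ∈ S | R K l} :=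
        sum_card_bipartiteAbove_eq_sum_card_bipartiteBelow R
    _ ≤ #L • d := sum_le_card_nsmul _ _ _ h
    _ = d * #L := by rw [smul_eq_mul, mul_comm]

theorem IsSweep.exists_cutting_nat {f : ℕ → α → γ} (hf : IsSweep f) (hq : 0 < q)
    (hinj : ∀ τ, Set.InjOn (f τ) P) (time : β → ℕ) {I : β → Set γ}
    [∀ l, DecidablePred (· ∈ I l)] (hI : ∀ l ∈ L, (I l).OrdConnected)
    (hInc : ∀ l ∈ L, ∀ p ∈ P, Inc p l → f (time l) p ∈ I l)
    (hpoor : ∀ l ∈ L, #{p ∈ P | f (time l) p ∈ I l} ≤ q) :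
    ∃ C : Cutting Inc P L (Σ _ : ℕ, ℕ), (∀ K, #(C.pts K) ≤ 2 * q) ∧
      ∑ K ∈ C.cells, #(C.lines K) ≤ 2 * #L ∧ (#C.cells : ℝ) ≤ #P / q + 2 + #P ^ 2 / q ^ 2 := by
  classical
  let T := L.sup time + 1
  have time_lt {l : β} (hl : l ∈ L) : time l < T := Nat.lt_succ_of_le (le_sup hl)
  obtain ⟨s, hsq, hs⟩ := hf.exists_blocks P hq T
  let blk (τ : ℕ) (p : α) : ℕ := (rank P (f τ) p + s) / q
  let cellAt (τ : ℕ) (p : α) := cell P blk q τ (blk τ p)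
  have card_blk_le (τ b : ℕ) : #{p ∈ P | blk τ p = b} ≤ q :=
    card_add_div_eq_le hq (rank_injOn (hinj τ)) s b
  let C : Cutting Inc P L (Σ _ : ℕ, ℕ) :=
    { cells := cells P blk q T (#P / q + 2)
      pts K := {p ∈ P | ∃ τ < T, cellAt τ p = K}
      lines K := {l ∈ L | ∃ p ∈ P, Inc p l ∧ cellAt (time l) p = K}
      pts_subset _ := filter_subset _ _
      lines_subset _ := filter_subset _ _
      exists_mem p hp l hl hpl := ⟨cellAt (time l) p,
        cell_mem_cells (time_lt hl).le (rank_add_div_lt hsq p),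
        mem_filter.2 ⟨hp, time l, time_lt hl, rfl⟩, mem_filter.2 ⟨hl, p, hp, hpl, rfl⟩⟩ }
  refine ⟨C, card_filter_cell_eq_le hq card_blk_le T, sum_card_filter_le _ fun l hl => ?_, ?_⟩
  · calc #{K ∈ C.cells | ∃ p ∈ P, Inc p l ∧ cellAt (time l) p = K}
        ≤ #(image (cell P blk q (time l)) (image (blk (time l)) {p ∈ P | f (time l) p ∈ I l})) := by
          refine card_le_card fun K hK => ?_
          obtain ⟨-, p, hp, hpl, rfl⟩ := mem_filter.1 hK
          exact mem_image_of_mem _ (mem_image_of_mem _ (mem_filter.2 ⟨hp, hInc l hl p hp hpl⟩))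
      _ ≤ 2 := card_image_le.trans (card_image_rank_add_div_le_two hq s (hI l hl) (hpoor l hl))
  · have hq' : (0 : ℝ) < q := by exact_mod_cast hq
    have changes : ((∑ τ ∈ range T, #{p ∈ P | blk (τ + 1) p ≠ blk τ p} : ℕ) : ℝ) ≤ #P ^ 2 / q := by
      rw [le_div_iff₀' hq']
      exact_mod_cast hs
    calc (#C.cells : ℝ) ≤ (#P / q + 2 : ℕ) + #P ^ 2 / q / q := by
          refine (card_cells_le P blk q T _).trans ?_
          gcongr
      _ ≤ #P / q + 2 + #P ^ 2 / q ^ 2 := by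
          rw [div_div, ← sq, Nat.cast_add, Nat.cast_ofNat]
          gcongr
          exact Nat.cast_div_le

theorem exists_monotone_forall_mem_exists_eq [LinearOrder ι] [Nonempty ι] (S : Finset ι) :
    ∃ x : ℕ → ι, Monotone x ∧ ∀ s ∈ S, ∃ τ, x τ = s := by
  obtain rfl | hS := S.eq_empty_or_nonempty
  · exact ⟨fun _ => Classical.arbitrary ι, monotone_const, by simp⟩
  have hlast : #S - 1 < #S := Nat.sub_lt hS.card_pos one_pos
  let e := S.orderEmbOfFin rfl
  refine ⟨fun τ => e ⟨min τ (#S - 1), by omega⟩, fun σ τ h => e.monotone ?_, fun s hs => ?_⟩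
  · exact min_le_min_right _ h
  · obtain ⟨i, rfl⟩ : s ∈ Set.range e := by simpa [e] using hs
    exact ⟨i, congrArg e (Fin.ext (min_eq_left (by omega)))⟩

/-- For points and lines of the plane, `time l` is the slope of `l` and `I l` consists of the keys
whose height is the intercept of `l`. -/
theorem IsSweep.exists_cutting [LinearOrder ι] [Nonempty ι] {f : ι → α → γ} (hf : IsSweep f)
    (hq : 0 < q) (hinj : ∀ τ, Set.InjOn (f τ) P) (time : β → ι) {I : β → Set γ}
    [∀ l, DecidablePred (· ∈ I l)] (hI : ∀ l ∈ L, (I l).OrdConnected)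
    (hInc : ∀ l ∈ L, ∀ p ∈ P, Inc p l → f (time l) p ∈ I l)
    (hpoor : ∀ l ∈ L, #{p ∈ P | f (time l) p ∈ I l} ≤ q) :
    ∃ C : Cutting Inc P L (Σ _ : ℕ, ℕ), (∀ K, #(C.pts K) ≤ 2 * q) ∧
      ∑ K ∈ C.cells, #(C.lines K) ≤ 2 * #L ∧ (#C.cells : ℝ) ≤ #P / q + 2 + #P ^ 2 / q ^ 2 := by
  obtain ⟨x, hx, hxL⟩ := exists_monotone_forall_mem_exists_eq (L.image time)
  choose! step hstep using fun l hl => hxL (time l) (mem_image_of_mem time hl)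
  refine (hf.comp hx).exists_cutting_nat hq (fun τ => hinj (x τ)) step hI ?_ ?_ <;>
  · intro l hl
    simpa only [hstep l hl] using by first | exact hInc l hl | exact hpoor l hl

end SweepCutting

section Lines

/-- Incidence of points and lines in the plane. -/
def OnLine (p : Plane) (l : Line) : Prop := p ∈ l.1

theorem ncard_incidences [∀ p, DecidablePred (OnLine p)] (P : Finset Plane) (L : Finset Line) :
    (incidences (P : Set Plane) (L : Set Line)).ncard = #(interedges OnLine P L) := by
  rw [← Set.ncard_coe_finset]
  congr 1
  ext x
  simp [incidences, mem_interedges_iff, OnLine]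

theorem direction_eq_span {l : Line} {v : Plane} (hv : v ≠ 0) (hvl : v ∈ l.1.direction) :
    l.1.direction = Submodule.span ℝ {v} :=
  (Submodule.eq_of_le_of_finrank_eq ((Submodule.span_singleton_le_iff_mem _ _).2 hvl)
    (by rw [finrank_span_singleton hv, l.2])).symm

theorem isPartialLinear_onLine : IsPartialLinear OnLine := by
  intro p q a b hab hpa hpb hqa hqb
  by_contra hpq
  have hne : q -ᵥ p ≠ 0 := vsub_ne_zero.2 (Ne.symm hpq)
  refine hab (Subtype.ext (AffineSubspace.ext_of_direction_eq ?_ ⟨p, hpa, hpb⟩))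
  rw [direction_eq_span hne (AffineSubspace.vsub_mem_direction hqa hpa),
    direction_eq_span hne (AffineSubspace.vsub_mem_direction hqb hpb)]

theorem Plane.ext {p q : Plane} (h₀ : p 0 = q 0) (h₁ : p 1 = q 1) : p = q := by
  ext i
  fin_cases i
  · exact h₀
  · exact h₁

theorem mem_span_singleton_iff_mul_eq_mul {u v : Plane} (hv : v ≠ 0) :
    u ∈ Submodule.span ℝ {v} ↔ v 0 * u 1 = v 1 * u 0 := by
  rw [Submodule.mem_span_singleton]
  constructor
  · rintro ⟨k, rfl⟩
    simp only [PiLp.smul_apply, smul_eq_mul]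
    ring
  · intro h
    by_cases h₀ : v 0 = 0
    · have h₁ : v 1 ≠ 0 := fun h₁ => hv (Plane.ext h₀ h₁)
      have hu : u 0 = 0 := by simpa [h₀, h₁] using h.symm
      exact ⟨u 1 / v 1, Plane.ext (by simp [h₀, hu]) (by simp [h₁])⟩
    · exact ⟨u 0 / v 0, Plane.ext (by simp [h₀]) (by simp; field_simp; linarith)⟩

theorem exists_forall_onLine_iff (l : Line) : ∃ o v : Plane, v ≠ 0 ∧
    ∀ p, OnLine p l ↔ v 0 * (p 1 - o 1) = v 1 * (p 0 - o 0) := by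
  have hdir : l.1.direction ≠ ⊥ := Submodule.one_le_finrank_iff.1 l.2.ge
  obtain ⟨o, ho⟩ : (l.1 : Set Plane).Nonempty := by
    rw [AffineSubspace.nonempty_iff_ne_bot]
    exact fun h => hdir (by rw [h, AffineSubspace.direction_bot])
  obtain ⟨v, hvl, hv⟩ := Submodule.exists_mem_ne_zero_of_ne_bot hdir
  refine ⟨o, v, hv, fun p => ?_⟩
  rw [OnLine, ← AffineSubspace.vsub_right_mem_direction_iff_mem ho, direction_eq_span hv hvl,
    mem_span_singleton_iff_mul_eq_mul hv]
  rfl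

/-- The lines without a slope. -/
def IsVertical (l : Line) : Prop := ∃ c : ℝ, ∀ p : Plane, OnLine p l ↔ p 0 = c

theorem exists_slope_intercept {l : Line} (hl : ¬ IsVertical l) :
    ∃ s c : ℝ, ∀ p : Plane, OnLine p l ↔ p 1 - s * p 0 = c := by
  obtain ⟨o, v, hv, hmem⟩ := exists_forall_onLine_iff l
  have h₀ : v 0 ≠ 0 := by
    intro h₀
    have h₁ : v 1 ≠ 0 := fun h₁ => hv (Plane.ext h₀ h₁)
    exact hl ⟨o 0, fun p => by rw [hmem, h₀, zero_mul, zero_eq_mul, sub_eq_zero, or_iff_right h₁]⟩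
  refine ⟨v 1 / v 0, o 1 - v 1 / v 0 * o 0, fun p => ?_⟩
  rw [hmem]
  field_simp
  constructor <;> intro h <;> linarith

theorem card_interedges_le_of_isVertical [∀ p, DecidablePred (OnLine p)] (P : Finset Plane)
    {L : Finset Line} (hL : ∀ l ∈ L, IsVertical l) : #(interedges OnLine P L) ≤ #P := by
  rw [card_interedges_eq_sum_left, card_eq_sum_ones]
  refine sum_le_sum fun p _ => card_le_one.2 fun a ha b hb => ?_
  obtain ⟨haL, ha⟩ := mem_filter.1 ha
  obtain ⟨hbL, hb⟩ := mem_filter.1 hb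
  obtain ⟨c, hc⟩ := hL a haL
  obtain ⟨d, hd⟩ := hL b hbL
  exact Subtype.ext (SetLike.ext fun r => (hc r).trans
    (by rw [← (hc p).1 ha, (hd p).1 hb]; exact (hd r).symm))

end Lines

section DualLines

/-- The height over `s` of the line `y = p 1 - s * p 0` dual to the point `p`. Ties are broken by
the order of the lines just after `s`, so that distinct points always have distinct keys. -/
def dualKey (s : ℝ) (p : Plane) : ℝ ×ₗ ℝ := toLex (p 1 - s * p 0, -p 0)

theorem dualKey_injective (s : ℝ) : Function.Injective (dualKey s) := by
  intro p q h
  obtain ⟨h₁, h₀⟩ := Prod.ext_iff.1 (toLex_inj.1 h)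
  have h₀ : p 0 = q 0 := neg_injective h₀
  exact Plane.ext h₀ (by simpa [h₀] using h₁)

theorem dualKey_lt_dualKey {s : ℝ} {p q : Plane} :
    dualKey s p < dualKey s q ↔
      p 1 - s * p 0 < q 1 - s * q 0 ∨ p 1 - s * p 0 = q 1 - s * q 0 ∧ q 0 < p 0 := by
  simp [dualKey, Prod.Lex.toLex_lt_toLex]

theorem isSweep_dualKey : IsSweep dualKey := by
  intro p q
  simp only [dualKey_lt_dualKey]
  obtain h | h := lt_or_ge (q 0) (p 0)
  · refine Or.inl fun x y hxy hx => ?_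
    have hle : p 1 - y * p 0 ≤ q 1 - y * q 0 := by
      rcases hx with hx | ⟨hx, _⟩ <;> nlinarith
    exact hle.lt_or_eq.imp_right fun heq => ⟨heq, h⟩
  · refine Or.inr fun x y hxy hy => ?_
    obtain hy | ⟨-, hy⟩ := hy
    · exact Or.inl (by nlinarith)
    · exact absurd hy h.not_gt

theorem exists_cutting_of_not_isVertical [∀ p, DecidablePred (OnLine p)] {P : Finset Plane}
    {L : Finset Line} {q : ℕ} (hq : 0 < q) (hL : ∀ l ∈ L, ¬ IsVertical l)
    (hpoor : ∀ l ∈ L, #{p ∈ P | OnLine p l} ≤ q) :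
    ∃ C : Cutting OnLine P L (Σ _ : ℕ, ℕ), (∀ K, #(C.pts K) ≤ 2 * q) ∧
      ∑ K ∈ C.cells, #(C.lines K) ≤ 2 * #L ∧
      (#C.cells : ℝ) ≤ #P / q + 2 + #P ^ 2 / q ^ 2 := by
  classical
  choose! slope icpt hl using fun l h => exists_slope_intercept (hL l h)
  refine isSweep_dualKey.exists_cutting hq (fun s => (dualKey_injective s).injOn) slope
    (I := fun l => {k | (ofLex k).1 = icpt l})
    (fun l _ => Set.ordConnected_singleton.preimage_mono Prod.Lex.monotone_fst_ofLex)
    (fun l hlL p _ hpl => (hl l hlL p).1 hpl) fun l hlL => ?_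
  refine (card_le_card fun p hp => ?_).trans (hpoor l hlL)
  obtain ⟨hpP, hpl⟩ := mem_filter.1 hp
  exact mem_filter.2 ⟨hpP, (hl l hlL p).2 hpl⟩

end DualLines

theorem GridFree.card_interedges_onLine_le [∀ p, DecidablePred (OnLine p)] {t q w : ℕ}
    {P : Finset Plane} {L : Finset Line} (h : GridFree OnLine t P L) (ht : 1 ≤ t) (hq : 0 < q)
    (hw : 1 ≤ w) :
    (#(interedges OnLine P L) : ℝ) ≤ #P + #P ^ 2 / q +
      (2 * #L / w + (#P / q + 2 + #P ^ 2 / q ^ 2)) *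
        (2 * q + 4 * t * (w : ℝ) ^ (2 - 1 / t : ℝ)) := by
  classical
  let vertical : Finset Line := {l ∈ L | IsVertical l}
  let rich : Finset Line := {l ∈ L | q < #{p ∈ P | OnLine p l}}
  let rest : Finset Line := {l ∈ L | ¬ IsVertical l ∧ #{p ∈ P | OnLine p l} ≤ q}
  have hL : L = vertical ∪ rich ∪ rest := by
    ext l
    simp only [vertical, rich, rest, mem_union, mem_filter]
    have := le_or_gt #{p ∈ P | OnLine p l} q
    tauto
  have vertical_le : #(interedges OnLine P vertical) ≤ #P :=
    card_interedges_le_of_isVertical P fun l hl => (mem_filter.1 hl).2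
  have rich_le : (#(interedges OnLine P rich) : ℝ) ≤ #P ^ 2 / q := by
    rw [le_div_iff₀' (by exact_mod_cast hq)]
    exact_mod_cast mul_card_interedges_le_of_rich isPartialLinear_onLine
      fun l (hl : l ∈ rich) => (mem_filter.1 hl).2
  obtain ⟨C, hpts, hlines, hcells⟩ := exists_cutting_of_not_isVertical (L := rest) hq
    (fun l hl => (mem_filter.1 hl).2.1) (fun l hl => (mem_filter.1 hl).2.2)
  have rest_le := (h.mono Subset.rfl (filter_subset _ _)).card_interedges_le_of_cutting
    isPartialLinear_onLine ht hw C hpts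
    (hlines.trans (Nat.mul_le_mul_left 2 (card_le_card (filter_subset _ L))))
  push_cast at rest_le
  have union_le : (#(interedges OnLine P L) : ℝ) ≤ #(interedges OnLine P vertical) +
      #(interedges OnLine P rich) + #(interedges OnLine P rest) := by
    rw [congrArg (interedges OnLine P) hL]
    exact_mod_cast (card_interedges_union_right_le P _ rest).trans
      (Nat.add_le_add_right (card_interedges_union_right_le P vertical rich) _)
  refine union_le.trans (add_le_add (add_le_add (by exact_mod_cast vertical_le) rich_le)
    (rest_le.trans ?_))
  gcongr

section Isomorphism

theorem isomorphic_range {X Y : Type*} {φ φ' : X → Plane} {ψ ψ' : Y → Line}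
    (hφ : Function.Injective φ) (hφ' : Function.Injective φ') (hψ : Function.Injective ψ)
    (hψ' : Function.Injective ψ') (h : ∀ x y, OnLine (φ x) (ψ y) ↔ OnLine (φ' x) (ψ' y)) :
    Isomorphic (Set.range φ) (Set.range ψ) (Set.range φ') (Set.range ψ') := by
  let e := (Equiv.ofInjective φ hφ).symm.trans (Equiv.ofInjective φ' hφ')
  let e' := (Equiv.ofInjective ψ hψ).symm.trans (Equiv.ofInjective ψ' hψ')
  have hinc (p : Set.range φ) (l : Set.range ψ) :
      ((e p).1, (e' l).1) ∈ incidences (Set.range φ') (Set.range ψ') ↔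
        (p.1, l.1) ∈ incidences (Set.range φ) (Set.range ψ) := by
    obtain ⟨_, x, rfl⟩ := p
    obtain ⟨_, y, rfl⟩ := l
    simpa [incidences, OnLine, e, e'] using (h x y).symm
  refine ⟨⟨Equiv.sumCongr e e', ?_⟩⟩
  rintro (p | l) (q | k)
  · exact Iff.rfl
  · exact hinc p k
  · exact hinc q l
  · exact Iff.rfl

namespace IsGrid

variable {α β ι κ : Type*} {Inc : α → β → Prop} {a : ι → β} {b : κ → β} {p : ι → κ → α}

theorem injective_points (h : IsGrid Inc a b p) : Function.Injective p.uncurry := by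
  rintro ⟨i, j⟩ ⟨k, l⟩ (heq : p i j = p k l)
  exact Prod.ext ((h.inc_left k l i).1 (heq ▸ (h.inc_left i j i).2 rfl))
    ((h.inc_right k l j).1 (heq ▸ (h.inc_right i j j).2 rfl))

theorem injective_lines [Nonempty ι] [Nontrivial κ] (h : IsGrid Inc a b p) :
    Function.Injective (Sum.elim a b) := by
  obtain ⟨i₀⟩ := ‹Nonempty ι›
  obtain ⟨j₀, j₁, hj⟩ := exists_pair_ne κ
  refine Function.Injective.sumElim (fun i k hik => ?_) (fun j l hjl => ?_) fun i j hij => hj ?_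
  · exact (h.inc_left k j₀ i).1 (hik ▸ (h.inc_left k j₀ k).2 rfl)
  · exact (h.inc_right i₀ l j).1 (hjl ▸ (h.inc_right i₀ l l).2 rfl)
  · have hall (l : κ) : j = l := (h.inc_right i l j).1 (hij ▸ (h.inc_left i l i).2 rfl)
    exact (hall j₀).symm.trans (hall j₁)

theorem isomorphic [Nonempty ι] [Nontrivial κ] {a a' : ι → Line} {b b' : κ → Line}
    {p p' : ι → κ → Plane} (h : IsGrid OnLine a b p) (h' : IsGrid OnLine a' b' p') :
    Isomorphic (Set.range p.uncurry) (Set.range a ∪ Set.range b)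
      (Set.range p'.uncurry) (Set.range a' ∪ Set.range b') := by
  rw [← Set.Sum.elim_range, ← Set.Sum.elim_range]
  refine isomorphic_range h.injective_points h'.injective_points h.injective_lines
    h'.injective_lines ?_
  rintro ⟨i, j⟩ (k | k)
  · exact (h.inc_left i j k).trans (h'.inc_left i j k).symm
  · exact (h.inc_right i j k).trans (h'.inc_right i j k).symm

end IsGrid

/-- Choosing for each crossing a pair of lines that meet there is injective, hence bijective when
the two sets have the same size. -/
theorem exists_equiv_crossings (L₁ L₂ : Finset Line)
    (h : (crossings (L₁ : Set Line) (L₂ : Set Line)).ncard = #L₁ * #L₂) :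
    ∃ e : L₁ × L₂ ≃ crossings (L₁ : Set Line) (L₂ : Set Line),
      ∀ l₁ l₂, (l₁.1.1 : Set Plane) ∩ l₂.1.1 = {(e (l₁, l₂)).1} := by
  choose a ha b hb hab using fun x : crossings (L₁ : Set Line) (L₂ : Set Line) => x.2
  let g (x : crossings (L₁ : Set Line) (L₂ : Set Line)) : L₁ × L₂ := (⟨a x, ha x⟩, ⟨b x, hb x⟩)
  have hg : Function.Injective g := by
    intro x y hxy
    simp only [g, Prod.mk.injEq, Subtype.mk.injEq] at hxy
    exact Subtype.ext (Set.singleton_injective (by rw [← hab x, ← hab y, hxy.1, hxy.2]))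
  have hcard : Nat.card (L₁ × L₂) ≤ Nat.card (crossings (L₁ : Set Line) (L₂ : Set Line)) := by
    rw [Nat.card_coe_set_eq, h]; simp
  let e := Equiv.ofBijective g (hg.bijective_of_nat_card_le hcard)
  refine ⟨e.symm, fun l₁ l₂ => ?_⟩
  obtain ⟨h₁, h₂⟩ := Prod.ext_iff.1 (e.apply_symm_apply (l₁, l₂))
  rw [← congrArg Subtype.val h₁, ← congrArg Subtype.val h₂]
  exact hab _

theorem exists_isGrid_of_ncard_crossings (L₁ L₂ : Finset Line)
    (h : (crossings (L₁ : Set Line) (L₂ : Set Line)).ncard = #L₁ * #L₂) :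
    ∃ p : L₁ → L₂ → Plane, IsGrid OnLine Subtype.val Subtype.val p ∧
      Set.range p.uncurry = crossings (L₁ : Set Line) (L₂ : Set Line) := by
  obtain ⟨e, he⟩ := exists_equiv_crossings L₁ L₂ h
  have hiff (l₁ : L₁) (l₂ : L₂) (q : Plane) :
      OnLine q l₁ ∧ OnLine q l₂ ↔ q = (e (l₁, l₂)).1 := Set.ext_iff.1 (he l₁ l₂) q
  have hmem l₁ l₂ := (hiff l₁ l₂ _).2 rfl
  refine ⟨fun l₁ l₂ => (e (l₁, l₂)).1, ⟨fun i j k => ⟨fun hk => ?_, ?_⟩,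
    fun i j k => ⟨fun hk => ?_, ?_⟩⟩, ?_⟩
  · have := (hiff k j _).1 ⟨hk, (hmem i j).2⟩
    exact (Prod.ext_iff.1 (e.injective (Subtype.ext this))).1.symm
  · rintro rfl
    exact (hmem k j).1
  · have := (hiff i k _).1 ⟨(hmem i j).1, hk⟩
    exact (Prod.ext_iff.1 (e.injective (Subtype.ext this))).2.symm
  · rintro rfl
    exact (hmem i k).2
  · exact (e.surjective.range_comp Subtype.val).trans Subtype.range_val

theorem gridFree_of_not_containsCopy {t : ℕ} (ht : 1 < t) {L₁ L₂ : Finset Line} (h₁ : #L₁ = t)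
    (h₂ : #L₂ = t) (h : (crossings (L₁ : Set Line) (L₂ : Set Line)).ncard = t ^ 2)
    {P : Finset Plane} {L : Finset Line}
    (hcopy : ¬ ContainsCopy (P : Set Plane) (L : Set Line)
      (crossings (L₁ : Set Line) (L₂ : Set Line)) ((L₁ : Set Line) ∪ (L₂ : Set Line))) :
    GridFree OnLine t P L := by
  rintro ⟨a, b, p, ha, hb, hp, hg⟩
  obtain ⟨p₀, hg₀, hp₀⟩ := exists_isGrid_of_ncard_crossings L₁ L₂ (by rw [h, h₁, h₂, sq])
  let e₁ := L₁.equivFinOfCardEq h₁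
  let e₂ := L₂.equivFinOfCardEq h₂
  have : Nontrivial L₂ := e₂.nontrivial_congr.2 (Fin.nontrivial_iff_two_le.2 ht)
  have : Nonempty L₁ := ⟨e₁.symm ⟨0, by omega⟩⟩
  refine hcopy ⟨Set.range (fun i j => p (e₁ i) (e₂ j)).uncurry, ?_,
    Set.range (a ∘ e₁) ∪ Set.range (b ∘ e₂), ?_, ?_⟩
  · rintro _ ⟨x, rfl⟩
    exact hp _ _
  · rintro _ (⟨i, rfl⟩ | ⟨j, rfl⟩)
    exacts [ha _, hb _]
  · simpa [hp₀] using (hg.reindex e₁ e₂).isomorphic hg₀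

end Isomorphism

section Balance

variable {t m n r : ℝ}

/-- The ratio `r` for which `m / r` points and `n / r ^ 2` lines per cell balance the two terms of
the pairing bound. -/
noncomputable def balanceRatio (t m n : ℝ) : ℝ :=
  n ^ ((2 * t - 1) / (3 * t - 2)) * m ^ (-(t / (3 * t - 2)))

theorem balanceRatio_pos (hm : 0 < m) (hn : 0 < n) : 0 < balanceRatio t m n := by
  unfold balanceRatio
  positivity

theorem rpow_mul_rpow_eq_balanceRatio_mul (ht : 1 ≤ t) (hm : 0 < m) :
    m ^ ((2 * t - 2) / (3 * t - 2)) * n ^ ((2 * t - 1) / (3 * t - 2)) =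
      balanceRatio t m n * m := by
  have hd : t * 3 - 2 ≠ 0 := by linarith
  have hexp : (2 * t - 2) / (3 * t - 2) = -(t / (3 * t - 2)) + 1 := by field_simp; ring
  rw [balanceRatio, hexp, Real.rpow_add_one hm.ne']
  ring

theorem balanceRatio_rpow (ht : 1 ≤ t) (hm : 0 < m) (hn : 0 < n) :
    balanceRatio t m n ^ ((3 * t - 2) / t) = n ^ (2 - 1 / t) / m := by
  have hd : t * 3 - 2 ≠ 0 := by linarith
  have ht₀ : t ≠ 0 := by linarith
  have hexp : (2 * t - 1) / (3 * t - 2) * ((3 * t - 2) / t) = 2 - 1 / t := by field_simp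
  have hexp' : -(t / (3 * t - 2)) * ((3 * t - 2) / t) = -1 := by field_simp
  rw [balanceRatio, Real.mul_rpow (by positivity) (by positivity), ← Real.rpow_mul hn.le,
    ← Real.rpow_mul hm.le, hexp, hexp', Real.rpow_neg_one, ← div_eq_mul_inv]

theorem rpow_le_of_balanceRatio_le_one (ht : 1 ≤ t) (hm : 0 < m) (hn : 0 < n)
    (hr : balanceRatio t m n ≤ 1) : n ^ (2 - 1 / t) ≤ m := by
  rw [← div_le_one hm, ← balanceRatio_rpow ht hm hn]
  exact Real.rpow_le_one (balanceRatio_pos hm hn).le hr (div_nonneg (by linarith) (by linarith))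

theorem div_balanceRatio_sq_rpow (ht : 1 ≤ t) (hm : 0 < m) (hn : 0 < n) :
    (n / balanceRatio t m n ^ 2) ^ (2 - 1 / t) = m / balanceRatio t m n := by
  have ht₀ : t ≠ 0 := by linarith
  have hr := balanceRatio_pos (t := t) hm hn
  have hexp : (2 : ℝ) * (2 - 1 / t) = (3 * t - 2) / t + 1 := by field_simp; ring
  rw [Real.div_rpow hn.le (by positivity), ← Real.rpow_natCast, ← Real.rpow_mul hr.le,
    Nat.cast_ofNat, hexp, Real.rpow_add_one hr.ne', balanceRatio_rpow ht hm hn]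
  field_simp

theorem balanceRatio_sq_le (ht : 1 ≤ t) (hm : 0 < m) (hn : 0 < n) (h : n ≤ m ^ 2) :
    balanceRatio t m n ^ 2 ≤ n := by
  set r := balanceRatio t m n with hr
  have hr₀ : 0 < r := balanceRatio_pos hm hn
  have hu : 0 < n / r ^ 2 := by positivity
  have ht' : 1 / t ≤ 1 := (div_le_one (by linarith)).2 ht
  by_contra! hlt
  have hu₁ : n / r ^ 2 < 1 := (div_lt_one (by positivity)).2 hlt
  have upper : m / r ≤ n / r ^ 2 := by
    rw [hr, ← div_balanceRatio_sq_rpow ht hm hn, ← hr]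
    exact Real.rpow_le_self_of_le_one hu.le hu₁.le (by linarith)
  have lower : n / r ^ 2 ≤ (m / r) ^ 2 := by
    rw [div_pow]
    gcongr
  have : (m / r) ^ 2 ≤ (n / r ^ 2) ^ 2 := by gcongr
  nlinarith

theorem le_natCeil_and_natCeil_le_two_mul {x : ℝ} (hx : 1 ≤ x) : x ≤ ⌈x⌉₊ ∧ (⌈x⌉₊ : ℝ) ≤ 2 * x :=
  ⟨Nat.le_ceil x, by linarith [Nat.ceil_lt_add_one (zero_le_one.trans hx)]⟩

theorem cells_le_six_mul_sq {q w : ℝ} (hr : 1 ≤ r) (hq₀ : 0 ≤ m / q) (hq : m / q ≤ r)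
    (hw : n / w ≤ r ^ 2) : 2 * n / w + (m / q + 2 + m ^ 2 / q ^ 2) ≤ 6 * r ^ 2 := by
  have hsq : (m / q) ^ 2 ≤ r ^ 2 := by gcongr
  rw [mul_div_assoc, ← div_pow]
  nlinarith

theorem two_mul_add_four_mul_rpow_le {q w x y : ℝ} (ht : 1 ≤ t) (hy : 0 ≤ y)
    (hx : x ^ (2 - 1 / t) = y) (hw₀ : 0 ≤ w) (hw : w ≤ 2 * x) (hq : q ≤ 2 * y) :
    2 * q + 4 * t * w ^ (2 - 1 / t) ≤ 20 * (t * y) := by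
  have hexp₀ : 0 ≤ 1 / t := by positivity
  have hexp : 1 / t ≤ 1 := (div_le_one (by linarith)).2 ht
  have hw' : w ^ (2 - 1 / t) ≤ 4 * y :=
    calc w ^ (2 - 1 / t) ≤ (2 * x) ^ (2 - 1 / t) := Real.rpow_le_rpow hw₀ hw (by linarith)
      _ = 2 ^ (2 - 1 / t) * y := by rw [Real.mul_rpow (by norm_num) (by linarith), hx]
      _ ≤ 2 ^ (2 : ℝ) * y := by
          gcongr
          · norm_num
          · linarith
      _ = 4 * y := by norm_num
  have hy' : y ≤ t * y := le_mul_of_one_le_left hy ht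
  have : 4 * t * w ^ (2 - 1 / t) ≤ 4 * t * (4 * y) := by gcongr
  linarith

end Balance

section MainBound

variable [∀ p, DecidablePred (OnLine p)] {t : ℕ} {P : Finset Plane} {L : Finset Line}

theorem GridFree.card_interedges_onLine_le_of_balanced (h : GridFree OnLine t P L) (ht : 1 ≤ t)
    {r : ℝ} (hr : 1 ≤ r) (hrP : r ≤ #P) (hrL : r ^ 2 ≤ #L)
    (hbal : (#L / r ^ 2 : ℝ) ^ (2 - 1 / t : ℝ) = #P / r) :
    (#(interedges OnLine P L) : ℝ) ≤ #P + r * #P + 120 * (t * (r * #P)) := by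
  have hr₀ : 0 < r := zero_lt_one.trans_le hr
  have hPr : 1 ≤ #P / r := (one_le_div hr₀).2 hrP
  have hLr : 1 ≤ #L / r ^ 2 := (one_le_div (by positivity)).2 hrL
  obtain ⟨hq, hq'⟩ := le_natCeil_and_natCeil_le_two_mul hPr
  obtain ⟨hw, hw'⟩ := le_natCeil_and_natCeil_le_two_mul hLr
  set q := ⌈#P / r⌉₊
  set w := ⌈#L / r ^ 2⌉₊
  have hq₀ : 0 < q := Nat.ceil_pos.2 (zero_lt_one.trans_le hPr)
  have hw₀ : 0 < w := Nat.ceil_pos.2 (zero_lt_one.trans_le hLr)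
  have hPq : (#P / q : ℝ) ≤ r := by
    rwa [div_le_iff₀ (by positivity), ← div_le_iff₀' hr₀]
  have hLw : (#L / w : ℝ) ≤ r ^ 2 := by
    rwa [div_le_iff₀ (by positivity), ← div_le_iff₀' (by positivity)]
  calc (#(interedges OnLine P L) : ℝ)
      ≤ #P + #P ^ 2 / q + (2 * #L / w + (#P / q + 2 + #P ^ 2 / q ^ 2)) *
          (2 * q + 4 * t * (w : ℝ) ^ (2 - 1 / t : ℝ)) := h.card_interedges_onLine_le ht hq₀ hw₀
    _ ≤ #P + r * #P + 6 * r ^ 2 * (20 * (t * (#P / r))) := by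
        gcongr
        · rw [sq, mul_div_right_comm]
          gcongr
        · exact cells_le_six_mul_sq hr (by positivity) hPq hLw
        · exact two_mul_add_four_mul_rpow_le (by exact_mod_cast ht) (by positivity) hbal
            (by positivity) hw' hq'
    _ = #P + r * #P + 120 * (t * (r * #P)) := by
        field_simp
        ring

theorem GridFree.card_interedges_onLine_le_main (h : GridFree OnLine t P L) (ht : 1 ≤ t) :
    (#(interedges OnLine P L) : ℝ) ≤ 121 * t *
      ((#P : ℝ) ^ ((2 * t - 2) / (3 * t - 2) : ℝ) * (#L : ℝ) ^ ((2 * t - 1) / (3 * t - 2) : ℝ) +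
        #P + #L) := by
  have ht' : (1 : ℝ) ≤ t := by exact_mod_cast ht
  obtain rfl | hP := P.eq_empty_or_nonempty
  · simp only [interedges_empty_left, card_empty, Nat.cast_zero]
    positivity
  obtain rfl | hL := L.eq_empty_or_nonempty
  · simp only [interedges, product_empty, filter_empty, card_empty, Nat.cast_zero]
    positivity
  have hm : (0 : ℝ) < #P := by exact_mod_cast hP.card_pos
  have hn : (0 : ℝ) < #L := by exact_mod_cast hL.card_pos
  rw [rpow_mul_rpow_eq_balanceRatio_mul ht' hm]
  set r := balanceRatio t #P #L
  have hr₀ : 0 < r := balanceRatio_pos hm hn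
  have hrP₀ : 0 < r * #P := by positivity
  have hrP : r * #P ≤ t * (r * #P) := le_mul_of_one_le_left hrP₀.le ht'
  have hPt : (#P : ℝ) ≤ t * #P := le_mul_of_one_le_left hm.le ht'
  have hLt : (#L : ℝ) ≤ t * #L := le_mul_of_one_le_left hn.le ht'
  obtain hr | hr := le_total r 1
  · have hle : 4 * t * (#L : ℝ) ^ (2 - 1 / t : ℝ) ≤ 4 * t * #P := by
      gcongr
      exact rpow_le_of_balanceRatio_le_one ht' hm hn hr
    linarith [h.card_interedges_le isPartialLinear_onLine ht]
  obtain hnm | hnm := le_total (#L : ℝ) (#P ^ 2)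
  · have hrL : r ^ 2 ≤ #L := balanceRatio_sq_le ht' hm hn hnm
    linarith [h.card_interedges_onLine_le_of_balanced ht hr
      (le_of_sq_le_sq (hrL.trans hnm) hm.le) hrL (div_balanceRatio_sq_rpow ht' hm hn)]
  · have hle : (#(interedges OnLine P L) : ℝ) ≤ #L + #P ^ 2 := by
      exact_mod_cast card_interedges_le_card_add_sq isPartialLinear_onLine P L
    linarith

end MainBound

end PointLine

theorem theorem1_general {t : ℕ} (ht : 1 < t) {L₁ L₂ : Finset PointLine.Line} (h₁ : L₁.card = t)
    (h₂ : L₂.card = t)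
    (h : (PointLine.crossings (L₁ : Set PointLine.Line) (L₂ : Set PointLine.Line)).ncard = t ^ 2)
    {P : Finset PointLine.Plane} {L : Finset PointLine.Line}
    (hcopy : ¬ PointLine.ContainsCopy (P : Set PointLine.Plane) (L : Set PointLine.Line)
      (PointLine.crossings (L₁ : Set PointLine.Line) (L₂ : Set PointLine.Line))
      ((L₁ : Set PointLine.Line) ∪ (L₂ : Set PointLine.Line))) :
    ((PointLine.incidences (P : Set PointLine.Plane) (L : Set PointLine.Line)).ncard : ℝ) ≤
      121 * t * ((P.card : ℝ) ^ ((2 * (t : ℝ) - 2) / (3 * (t : ℝ) - 2)) *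
        (L.card : ℝ) ^ ((2 * (t : ℝ) - 1) / (3 * (t : ℝ) - 2)) + P.card + L.card) := by
  classical
  rw [PointLine.ncard_incidences]
  exact (PointLine.gridFree_of_not_containsCopy ht h₁ h₂ h hcopy).card_interedges_onLine_le_main
    ht.le

theorem theorem1 (t : ℕ) (ht : 1 < t) :
    ∃ c : ℝ, ∀ L₁ L₂ : Finset PointLine.Line, L₁.card = t → L₂.card = t →
      (PointLine.crossings (L₁ : Set PointLine.Line) (L₂ : Set PointLine.Line)).ncard = t ^ 2 →
      ∀ (m n : ℕ) (P : Finset PointLine.Plane) (L : Finset PointLine.Line),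
        P.card = m → L.card = n →
        ¬ PointLine.ContainsCopy (P : Set PointLine.Plane) (L : Set PointLine.Line)
            (PointLine.crossings (L₁ : Set PointLine.Line) (L₂ : Set PointLine.Line))
            ((L₁ : Set PointLine.Line) ∪ (L₂ : Set PointLine.Line)) →
        ((PointLine.incidences (P : Set PointLine.Plane) (L : Set PointLine.Line)).ncard : ℝ) ≤
          c * ((m : ℝ) ^ ((2 * (t : ℝ) - 2) / (3 * (t : ℝ) - 2)) *
                (n : ℝ) ^ ((2 * (t : ℝ) - 1) / (3 * (t : ℝ) - 2)) +
              (m : ℝ) ^ (1 + 1 / (6 * (t : ℝ) - 3)) + (n : ℝ)) := by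
  have ht' : (1 : ℝ) < t := by exact_mod_cast ht
  refine ⟨121 * t, ?_⟩
  rintro L₁ L₂ h₁ h₂ h _ _ P L rfl rfl hcopy
  refine (theorem1_general ht h₁ h₂ h hcopy).trans ?_
  gcongr
  exact PointLine.natCast_le_rpow _ (le_add_of_nonneg_right (one_div_nonneg.2 (by linarith)))
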